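/- A linear decision tree on inputs $x\in\mathbb{R}^n$ is a rooted ternary tree in which every inner node is labelled by a vector $q\in\mathbb{R}^n$ and branches according to $\mathrm{sign}(\langle q,x\rangle)\in\{-,0,+\}$, and every leaf is labelled by an output; its depth is the maximal number of inner nodes on a path from the root to a leaf. For $H\subset\mathbb{R}^n$, it is a comparison decision tree for $H$ if every query $q$ is either a label query, $q\in H$, or a comparison query, $q=h'-h''$ with $h',h''\in H$. Let $H_n=\{0,1\}^n\setminus\{0^n\}$. Theorem. There is an absolute constant $C>0$ such that for every $n\ge 2$ the SUBSET-SUM problem on $n$ real numbers (given $x=(x_1,\dots,x_n)\in\mathbb{R}^n$, decide whether there is a nonempty $I\subseteq\{1,\dots,n\}$ with $\sum_{i\in I}x_i=0$) is solved, for all inputs $x \in \mathbb{R}^n$, by a comparison decision tree for $H_n$ of depth at most $C\,n^2\log n$. Likewise, there is a comparison decision tree for $H_n$ of depth at most $C\,n^2\log n$ that computes, for all $x\in\mathbb{R}^n$, the whole sign vector $\bigl(\mathrm{sign}(\langle h,x\rangle)\bigr)_{h\in H_n}$. In both trees all queries are linear forms with coefficients in $\{-1,0,1\}$, comparing two subset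 sums $\sum_{i\in I}x_i$ and $\sum_{j\in J}x_j$ (where $J=\emptyset$ for label queries). -/

import Mathlib

open scoped Matrix Pointwise

/-- A ternary linear decision tree on inputs `x ∈ ℝⁿ` with outputs in `α`. An inner node asks for
the sign of `⟨h, x⟩` and continues according to the answer in `{-, 0, +}`. -/
inductive LinearDecisionTree (n : ℕ) (α : Type) : Type where
  | leaf (a : α) : LinearDecisionTree n α
  | query (h : Fin n → ℝ) (next : SignType → LinearDecisionTree n α) : LinearDecisionTree n α

namespace LinearDecisionTree

variable {n : ℕ} {α : Type}

/-- The output of the tree on input `x`. -/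
noncomputable def eval (x : Fin n → ℝ) : LinearDecisionTree n α → α
  | leaf a => a
  | query h next => eval x (next (SignType.sign (h ⬝ᵥ x)))

/-- The depth: the largest number of queries on a path from the root to a leaf. -/
def depth : LinearDecisionTree n α → ℕ
  | leaf _ => 0
  | query _ next => 1 + Finset.univ.sup fun s => depth (next s)

/-- The set of all linear forms queried at the inner nodes of the tree. -/
def queries : LinearDecisionTree n α → Set (Fin n → ℝ)
  | leaf _ => ∅
  | query h next => {h} ∪ ⋃ s, queries (next s)

/-- A comparison decision tree for `H`: every query is a label query (an element of `H`) or a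
comparison query (a difference of two elements of `H`). -/
def IsComparison (H : Set (Fin n → ℝ)) (T : LinearDecisionTree n α) : Prop :=
  T.queries ⊆ H ∪ (H - H)

end LinearDecisionTree

/-- The point-location function `x ↦ (sign ⟨h, x⟩ : h ∈ H)`. -/
noncomputable def pointLocation {n : ℕ} (H : Set (Fin n → ℝ)) (x : Fin n → ℝ) : H → SignType :=
  fun h => SignType.sign ((h : Fin n → ℝ) ⬝ᵥ x)

/-- The set `{0,1}ⁿ \ {0ⁿ}`. -/
def subsetVectors (n : ℕ) : Set (Fin n → ℝ) :=
  {h | (∀ i, h i = 0 ∨ h i = 1) ∧ h ≠ 0}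

/-- `x` is a yes-instance of SUBSET-SUM: some nonempty subset of the entries has sum `0`. -/
def SubsetSum {n : ℕ} (x : Fin n → ℝ) : Prop :=
  ∃ I : Finset (Fin n), I.Nonempty ∧ ∑ i ∈ I, x i = 0

/-!
A set `H` has inference dimension at most `d` if, among any `d` of its elements and at every input
`x`, the sign of some `⟨h, x⟩` is determined by the answers to the label and comparison queries on
the others. For `{0, 1}`-vectors `d = O(n log n)`: among `k` vectors `g i` whose values at `x` have
the same sign and increasing absolute value, Siegel's lemma (a pigeonhole argument) yields a
relation between the differences `g (i + 1) - g i` with coefficients in `{-1, 0, 1}`. It exhibits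
some `g (p + 1)` as `g 0` plus a nonnegative combination of the earlier differences, all of whose
signs at `x` are known.

A random sequence of `20 d` elements of the set `R` of forms whose sign is still unknown infers at
least half of `R` at a given input, except with probability `2⁻ᵈ`. Averaging over one input in each
of the `2 ^ O(n ^ 2)` cells of the arrangement of all queries gives a single sample that fails in at
most a fraction `2⁻ᵈ` of the cells. The tree sorts this sample and recurses: at each leaf either `R`
has halved or only a `2⁻ᵈ` fraction of the cells is left, so there are `O(n + n ^ 2 / d)` rounds.

Sorting is by binary insertion weighted by the number of cells, as in Fredman's algorithm. An
insertion costs two queries beyond those that halve the number of cells, and there are only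
`O(n ^ 2)` such halvings, so a round costs `O(d)` and the total is
`O(n d + n ^ 2) = O(n ^ 2 log n)`.
-/

section Sampling

open Finset

variable {α : Type*} {I : Set α → α → Prop} {R : Finset α} {d s : ℕ}

/-- An abstract inference relation on the finite set `R`, of inference dimension at most `d`:
`I T h` is read as the sample `T` inferring `h`. -/
structure IsInferenceRel (I : Set α → α → Prop) (R : Finset α) (d : ℕ) : Prop where
  mono : ∀ {T T' : Set α} {h : α}, T ⊆ T' → I T h → I T' h
  of_mem : ∀ {T : Set α} {h : α}, h ∈ T → I T h
  exists_of_le_card : ∀ D ⊆ R, d ≤ #D → ∃ h ∈ D, I (↑D \ {h}) h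

open Classical in
/-- The elements of `R` that the sample `T` does not infer. -/
noncomputable def uninferred (I : Set α → α → Prop) (R : Finset α) (T : Set α) : Finset α :=
  {h ∈ R | ¬ I T h}

lemma uninferred_subset {T : Set α} : uninferred I R T ⊆ R := by
  classical exact filter_subset _ _

/-- A sample is poor if it leaves more than half of `R` uninferred. -/
def IsPoor (I : Set α → α → Prop) (R : Finset α) (T : Set α) : Prop :=
  #R < 2 * #(uninferred I R T)

lemma IsInferenceRel.uninferred_anti (hI : IsInferenceRel I R d) {T T' : Set α} (h : T ⊆ T') :
    uninferred I R T' ⊆ uninferred I R T := by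
  classical exact monotone_filter_right R fun _ _ hT' hT => hT' (hI.mono h hT)

lemma IsInferenceRel.isPoor_anti (hI : IsInferenceRel I R d) {T T' : Set α} (h : T ⊆ T')
    (hT' : IsPoor I R T') : IsPoor I R T :=
  hT'.trans_le (Nat.mul_le_mul_left 2 (card_le_card (hI.uninferred_anti h)))

/-- The sequences of `s` elements of `R`, read as `s` independent uniform draws. -/
abbrev samples (R : Finset α) (s : ℕ) : Finset (Fin s → α) :=
  Fintype.piFinset fun _ => R

lemma card_samples : #(samples R s) = #R ^ s := by
  simp

lemma sum_samples_succ (j : Fin (s + 1)) (F : (Fin (s + 1) → α) → ℝ) :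
    ∑ w ∈ samples R (s + 1), F w = ∑ w ∈ samples R s, ∑ a ∈ R, F (j.insertNth a w) := by
  rw [← sum_product']
  refine sum_nbij' (fun w => (j.removeNth w, w j)) (fun p => j.insertNth p.2 p.1) ?_ ?_ ?_ ?_ ?_ <;>
    simp +contextual [Fin.forall_iff_succAbove j, Fin.removeNth]

open Classical in
/-- How many entries of `w` are not inferred by the entries drawn before them, where `w 0` is the
last draw. -/
noncomputable def noveltyCount (I : Set α → α → Prop) : ∀ {s : ℕ}, (Fin s → α) → ℕ
  | 0, _ => 0
  | _ + 1, w => noveltyCount I (Fin.tail w) + if I (Set.range (Fin.tail w)) (w 0) then 0 else 1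

open Classical in
lemma noveltyCount_cons (a : α) (w : Fin s → α) :
    noveltyCount I (Fin.cons a w : Fin (s + 1) → α) =
      noveltyCount I w + if I (Set.range w) a then 0 else 1 := by
  simp [noveltyCount]

open Classical in
lemma sum_half_pow_le_of_isPoor {T : Set α} (hT : IsPoor I R T) :
    ∑ a ∈ R, (1 / 2 : ℝ) ^ (if I T a then 0 else 1) ≤ 3 / 4 * #R := by
  have hsplit : #{a ∈ R | I T a} + #(uninferred I R T) = #R := card_filter_add_card_filter_not _
  have hpoor : (#R : ℝ) < 2 * #(uninferred I R T) := mod_cast hT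
  have hsplit' : (#{a ∈ R | I T a} + #(uninferred I R T) : ℝ) = #R := mod_cast hsplit
  calc ∑ a ∈ R, (1 / 2 : ℝ) ^ (if I T a then 0 else 1)
      = #{a ∈ R | I T a} + 1 / 2 * #(uninferred I R T) := by
        simp [pow_ite, sum_ite, uninferred, mul_comm]
    _ ≤ 3 / 4 * #R := by linarith

open Classical in
lemma IsInferenceRel.sum_half_pow_noveltyCount_le (hI : IsInferenceRel I R d) (s : ℕ) :
    ∑ w ∈ samples R s with IsPoor I R (Set.range w), (1 / 2 : ℝ) ^ noveltyCount I w ≤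
      (3 / 4 * #R) ^ s := by
  induction s with
  | zero =>
    rw [sum_filter]
    simp only [noveltyCount, pow_zero, Fintype.piFinset_of_isEmpty, univ_unique, sum_singleton]
    split_ifs <;> norm_num
  | succ s ih =>
    rw [sum_filter, sum_samples_succ 0, pow_succ]
    refine le_trans ?_ (mul_le_mul_of_nonneg_right ih (by positivity))
    rw [sum_mul, sum_filter]
    refine sum_le_sum fun w _ => ?_
    simp only [Fin.insertNth_zero', Fin.range_cons, noveltyCount_cons]
    split_ifs with hw
    · calc ∑ a ∈ R, (if IsPoor I R (insert a (Set.range w)) then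
            (1 / 2 : ℝ) ^ (noveltyCount I w + if I (Set.range w) a then 0 else 1) else 0)
          ≤ ∑ a ∈ R, (1 / 2 : ℝ) ^ noveltyCount I w *
              (1 / 2) ^ (if I (Set.range w) a then 0 else 1) := by
            refine sum_le_sum fun a _ => ?_
            rw [← pow_add]
            exact ite_le_sup _ _ _ |>.trans (sup_le le_rfl (by positivity))
        _ ≤ (1 / 2) ^ noveltyCount I w * (3 / 4 * #R) := by
            rw [← mul_sum]
            exact mul_le_mul_of_nonneg_left (sum_half_pow_le_of_isPoor hw) (by positivity)
    · refine (sum_eq_zero fun a _ => if_neg fun h => hw ?_).le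
      exact hI.isPoor_anti (Set.subset_insert _ _) h

open Classical in
lemma IsInferenceRel.card_novel_lt (hI : IsInferenceRel I R d) {w : Fin (s + 1) → α}
    (hw : w ∈ samples R (s + 1)) :
    #{j | ¬ I (Set.range (j.removeNth w)) (w j)} < d := by
  set J : Finset (Fin (s + 1)) := {j | ¬ I (Set.range (j.removeNth w)) (w j)}
  have mem_range : ∀ {i j}, i ≠ j → w i ∈ Set.range (j.removeNth w) := fun {i j} hij => by
    obtain ⟨k, rfl⟩ := Fin.exists_succAbove_eq hij
    exact ⟨k, rfl⟩
  have novel : ∀ {j}, j ∈ J → ¬ I (Set.range (j.removeNth w)) (w j) := fun hj =>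
    (mem_filter.1 hj).2
  have inj : Set.InjOn w J := fun i _ j hj hij => by
    by_contra hne
    exact novel hj (hI.of_mem (hij ▸ mem_range hne))
  by_contra! hd
  obtain ⟨h, hh, hinf⟩ := hI.exists_of_le_card (J.image w)
    (image_subset_iff.2 fun j _ => Fintype.mem_piFinset.1 hw j) (by rwa [card_image_of_injOn inj])
  obtain ⟨j, hj, rfl⟩ := mem_image.1 hh
  refine novel hj (hI.mono (fun a ha => ?_) hinf)
  obtain ⟨ha, hne⟩ := ha
  obtain ⟨i, -, rfl⟩ := mem_image.1 (mem_coe.1 ha)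
  exact mem_range fun hij => hne (hij ▸ rfl)

open Classical in
/-- Given the unordered sample, each entry is equally likely to be the last draw. -/
lemma IsInferenceRel.sum_extend_le (hI : IsInferenceRel I R d) {φ : Set α → ℝ} (hφ : 0 ≤ φ) :
    (s + 1) * ∑ w ∈ samples R s, ∑ a ∈ R,
        2 ^ (if I (Set.range w) a then 0 else 1) * φ (insert a (Set.range w)) ≤
      (s + 1 + d) * ∑ w ∈ samples R (s + 1), φ (Set.range w) := by
  have last : ∀ j : Fin (s + 1), ∑ w ∈ samples R s, ∑ a ∈ R,
        2 ^ (if I (Set.range w) a then 0 else 1) * φ (insert a (Set.range w)) =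
      ∑ w ∈ samples R (s + 1),
        2 ^ (if I (Set.range (j.removeNth w)) (w j) then 0 else 1) * φ (Set.range w) := fun j => by
    simp only [sum_samples_succ j, Fin.range_insertNth, Fin.removeNth_insertNth,
      Fin.insertNth_apply_same]
    rfl
  have weight : ∀ w ∈ samples R (s + 1), ∑ j : Fin (s + 1),
      (2 : ℝ) ^ (if I (Set.range (j.removeNth w)) (w j) then 0 else 1) ≤ s + 1 + d := by
    intro w hw
    have two_pow_ite : ∀ p : Prop, (2 : ℝ) ^ (if p then 0 else 1) = 1 + if ¬ p then 1 else 0 :=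
      fun p => by by_cases hp : p <;> simp [hp, one_add_one_eq_two]
    have hlt : (#{j | ¬ I (Set.range (j.removeNth w)) (w j)} : ℝ) ≤ d :=
      mod_cast (hI.card_novel_lt hw).le
    simp only [two_pow_ite, sum_add_distrib, sum_boole]
    simpa using hlt
  calc _ = ∑ j : Fin (s + 1), ∑ w ∈ samples R (s + 1),
        2 ^ (if I (Set.range (j.removeNth w)) (w j) then 0 else 1) * φ (Set.range w) := by
        simp only [← last, sum_const, card_univ, Fintype.card_fin, nsmul_eq_mul, Nat.cast_succ]
    _ = ∑ w ∈ samples R (s + 1), (∑ j : Fin (s + 1),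
        2 ^ (if I (Set.range (j.removeNth w)) (w j) then 0 else 1)) * φ (Set.range w) := by
        simp only [sum_comm (s := univ), sum_mul]
    _ ≤ _ := by
        rw [mul_sum]
        exact sum_le_sum fun w hw => mul_le_mul_of_nonneg_right (weight w hw) (hφ _)

open Classical in
lemma IsInferenceRel.sum_two_pow_noveltyCount_mul_le (hI : IsInferenceRel I R d) {φ : Set α → ℝ}
    (hφ : 0 ≤ φ) (s : ℕ) :
    ∑ w ∈ samples R s, 2 ^ noveltyCount I w * φ (Set.range w) ≤
      (s + d).choose d * ∑ w ∈ samples R s, φ (Set.range w) := by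
  induction s generalizing φ with
  | zero => simp [noveltyCount]
  | succ s ih =>
    let ψ : Set α → ℝ := fun T => ∑ a ∈ R, 2 ^ (if I T a then 0 else 1) * φ (insert a T)
    have hψ : 0 ≤ ψ := fun T => sum_nonneg fun a _ => mul_nonneg (by positivity) (hφ _)
    have choose_succ : ((s + d).choose d * (s + 1 + d) : ℝ) = (s + 1 + d).choose d * (s + 1) := by
      have := Nat.choose_mul_succ_eq (s + d) d
      rw [show s + d + 1 - d = s + 1 by omega, show s + d + 1 = s + 1 + d by omega] at this
      exact mod_cast this
    have draw_last : ∑ w ∈ samples R (s + 1), 2 ^ noveltyCount I w * φ (Set.range w) =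
        ∑ w ∈ samples R s, 2 ^ noveltyCount I w * ψ (Set.range w) := by
      simp only [sum_samples_succ 0, Fin.insertNth_zero', Fin.range_cons, noveltyCount_cons, ψ,
        mul_sum, pow_add, mul_assoc]
    have hs : (0 : ℝ) < s + 1 := by positivity
    rw [draw_last]
    refine (ih hψ).trans (le_of_mul_le_mul_left ?_ hs)
    calc (s + 1) * ((s + d).choose d * ∑ w ∈ samples R s, ψ (Set.range w))
        = (s + d).choose d * ((s + 1) * ∑ w ∈ samples R s, ψ (Set.range w)) := by ring
      _ ≤ (s + d).choose d * ((s + 1 + d) * ∑ w ∈ samples R (s + 1), φ (Set.range w)) :=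
          mul_le_mul_of_nonneg_left (hI.sum_extend_le hφ) (Nat.cast_nonneg _)
      _ = (s + 1) * ((s + 1 + d).choose d * ∑ w ∈ samples R (s + 1), φ (Set.range w)) := by
          rw [← mul_assoc, choose_succ]; ring

open Classical in
/-- Poor samples have many novelties because a novelty is always likely to be drawn, but few
because a random ordering makes novelties rare; the two estimates are combined by Cauchy–Schwarz. -/
lemma IsInferenceRel.card_isPoor_sq_le (hI : IsInferenceRel I R d) (s : ℕ) :
    (#{w ∈ samples R s | IsPoor I R (Set.range w)} : ℝ) ^ 2 ≤
      (3 / 4 * #R) ^ s * ((s + d).choose d * #R ^ s) := by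
  set B : Finset (Fin s → α) := {w ∈ samples R s | IsPoor I R (Set.range w)}
  have two_pow_le : ∑ w ∈ B, (2 : ℝ) ^ noveltyCount I w ≤ (s + d).choose d * #R ^ s := by
    have := hI.sum_two_pow_noveltyCount_mul_le (φ := 1) zero_le_one s
    simp only [Pi.one_apply, mul_one, sum_const, card_samples, nsmul_eq_mul, Nat.cast_pow] at this
    exact (sum_le_sum_of_subset_of_nonneg (filter_subset _ _) fun _ _ _ => by positivity).trans this
  calc (#B : ℝ) ^ 2 = (∑ _w ∈ B, (1 : ℝ)) ^ 2 := by simp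
    _ ≤ (∑ w ∈ B, (1 / 2) ^ noveltyCount I w) * ∑ w ∈ B, 2 ^ noveltyCount I w :=
        sum_sq_le_sum_mul_sum_of_sq_le_mul _ (fun _ _ => by positivity) (fun _ _ => by positivity)
          fun w _ => by rw [← mul_pow]; norm_num
    _ ≤ (3 / 4 * #R) ^ s * ((s + d).choose d * #R ^ s) :=
        mul_le_mul (hI.sum_half_pow_noveltyCount_le s) two_pow_le
          (sum_nonneg fun _ _ => by positivity) (by positivity)

lemma choose_mul_pow_le_succ_pow (a s d : ℕ) :
    (s + d).choose d * a ^ s ≤ (a + 1) ^ (s + d) := by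
  have binomial : ∑ m ∈ range (s + d + 1), a ^ m * (s + d).choose m = (a + 1) ^ (s + d) := by
    simpa using (add_pow a 1 (s + d)).symm
  rw [← binomial, mul_comm, ← Nat.choose_symm_add]
  exact single_le_sum (f := fun m => a ^ m * (s + d).choose m) (fun _ _ => Nat.zero_le _)
    (mem_range.2 (by omega))

open Classical in
lemma IsInferenceRel.two_pow_mul_card_isPoor_le (hI : IsInferenceRel I R d) :
    2 ^ d * #{w ∈ samples R (20 * d) | IsPoor I R (Set.range w)} ≤ #R ^ (20 * d) := by
  have choose_le : ((20 * d + d).choose d : ℝ) ≤ 17 ^ (20 * d + d) / 16 ^ (20 * d) := by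
    rw [le_div_iff₀ (by positivity)]
    exact mod_cast choose_mul_pow_le_succ_pow 16 (20 * d) d
  have const_le : (2 ^ d) ^ 2 * ((3 / 4) ^ (20 * d) * (17 ^ (20 * d + d) / 16 ^ (20 * d))) ≤
      (1 : ℝ) := by
    have : (2 ^ d) ^ 2 * ((3 / 4) ^ (20 * d) * (17 ^ (20 * d + d) / 16 ^ (20 * d))) =
        (2 ^ 2 * ((3 / 4) ^ 20 * (17 ^ 21 / 16 ^ 20)) : ℝ) ^ d := by
      rw [← pow_mul, mul_comm d 2, show 20 * d + d = 21 * d by ring]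
      simp only [pow_mul, ← div_pow, ← mul_pow]
    rw [this]
    exact pow_le_one₀ (by positivity) (by norm_num)
  have hsq : ((2 : ℝ) ^ d * #{w ∈ samples R (20 * d) | IsPoor I R (Set.range w)}) ^ 2 ≤
      ((#R : ℝ) ^ (20 * d)) ^ 2 :=
    calc _ ≤ (2 ^ d) ^ 2 * ((3 / 4 * #R) ^ (20 * d) *
          (17 ^ (20 * d + d) / 16 ^ (20 * d) * #R ^ (20 * d)) : ℝ) := by
          rw [mul_pow]
          gcongr
          exact (hI.card_isPoor_sq_le _).trans (by gcongr)
      _ = (2 ^ d) ^ 2 * ((3 / 4) ^ (20 * d) * (17 ^ (20 * d + d) / 16 ^ (20 * d))) *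
          (#R ^ (20 * d)) ^ 2 := by ring
      _ ≤ (#R ^ (20 * d)) ^ 2 := mul_le_of_le_one_left (by positivity) const_le
  have hle := (pow_le_pow_iff_left₀ (by positivity) (by positivity) two_ne_zero).1 hsq
  exact mod_cast hle

open Classical in
lemma exists_sample_forall_isInferenceRel {ι : Type*} {C : Finset ι} {I : ι → Set α → α → Prop}
    (hI : ∀ c ∈ C, IsInferenceRel (I c) R d) (hR : R.Nonempty) :
    ∃ w ∈ samples R (20 * d), 2 ^ d * #{c ∈ C | IsPoor (I c) R (Set.range w)} ≤ #C := by
  refine exists_le_of_sum_le (Fintype.piFinset_nonempty.2 fun _ => hR) ?_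
  calc ∑ w ∈ samples R (20 * d), 2 ^ d * #{c ∈ C | IsPoor (I c) R (Set.range w)}
      = ∑ c ∈ C, 2 ^ d * #{w ∈ samples R (20 * d) | IsPoor (I c) R (Set.range w)} := by
        rw [← mul_sum, ← mul_sum]
        congr 1
        exact sum_card_bipartiteAbove_eq_sum_card_bipartiteBelow
          fun w c => IsPoor (I c) R (Set.range w)
    _ ≤ ∑ _c ∈ C, #R ^ (20 * d) := sum_le_sum fun c hc => (hI c hc).two_pow_mul_card_isPoor_le
    _ = ∑ _w ∈ samples R (20 * d), #C := by simp [mul_comm]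

end Sampling

section Cells

section SignPatterns

variable {𝕜 E : Type*} [Field 𝕜] [LinearOrder 𝕜] [AddCommGroup E] [Module 𝕜 E]
  {M : ℕ}

/-- The sign vectors that the linear forms `q i` realize on `X`, that is, the cells of the
arrangement of their kernels that meet `X`. -/
def signPatterns (q : Fin M → Module.Dual 𝕜 E) (X : Set E) : Set (Fin M → SignType) :=
  (fun x i => SignType.sign (q i x)) '' X

lemma signPatterns_cons (p : Module.Dual 𝕜 E) (q : Fin M → Module.Dual 𝕜 E) (X : Set E) :
    signPatterns (Fin.cons p q) X =
      ⋃ σ, (Fin.cons σ : _ → Fin (M + 1) → SignType) ''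
        signPatterns q {x ∈ X | SignType.sign (p x) = σ} := by
  have cons_apply : ∀ x, (fun i => SignType.sign ((Fin.cons p q : Fin (M + 1) → _) i x)) =
      Fin.cons (SignType.sign (p x)) fun i => SignType.sign (q i x) := fun x =>
    funext <| Fin.cases rfl fun _ => rfl
  ext π
  simp only [signPatterns, cons_apply, Set.mem_image, Set.mem_iUnion, Set.mem_sep_iff]
  constructor
  · rintro ⟨x, hx, rfl⟩
    exact ⟨_, _, ⟨x, ⟨hx, rfl⟩, rfl⟩, rfl⟩
  · rintro ⟨_, _, ⟨x, ⟨hx, rfl⟩, rfl⟩, rfl⟩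
    exact ⟨x, hx, rfl⟩

lemma ncard_signPatterns_cons_le_sum (p : Module.Dual 𝕜 E) (q : Fin M → Module.Dual 𝕜 E)
    (X : Set E) :
    (signPatterns (Fin.cons p q) X).ncard ≤
      ∑ σ, (signPatterns q {x ∈ X | SignType.sign (p x) = σ}).ncard := by
  rw [signPatterns_cons]
  exact (Set.ncard_iUnion_le_of_fintype _).trans
    (Finset.sum_le_sum fun σ _ => Set.ncard_image_le (Set.toFinite _))

lemma ncard_signPatterns_cons_le_of_le_ker {p : Module.Dual 𝕜 E} (q : Fin M → Module.Dual 𝕜 E)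
    {V : Submodule 𝕜 E} (h : V ≤ LinearMap.ker p) :
    (signPatterns (Fin.cons p q) V).ncard ≤ (signPatterns q V).ncard := by
  refine (Set.ncard_le_ncard ?_ (Set.toFinite _)).trans
    (Set.ncard_image_le (f := (Fin.cons 0 : _ → Fin (M + 1) → SignType)) (Set.toFinite _))
  rw [signPatterns_cons]
  refine Set.iUnion_subset fun σ => ?_
  rintro _ ⟨_, ⟨x, ⟨hx, rfl⟩, rfl⟩, rfl⟩
  refine ⟨_, ⟨x, hx, rfl⟩, ?_⟩
  rw [LinearMap.mem_ker.1 (h hx), sign_zero]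

variable [IsStrictOrderedRing 𝕜]

/-- A cell on both sides of the hyperplane `p = 0` crosses it, along the segment from `x` to `y`. -/
lemma signPatterns_inter_subset (p : Module.Dual 𝕜 E) (q : Fin M → Module.Dual 𝕜 E)
    (V : Submodule 𝕜 E) :
    signPatterns q {x ∈ (V : Set E) | SignType.sign (p x) = 1} ∩
        signPatterns q {x ∈ (V : Set E) | SignType.sign (p x) = -1} ⊆
      signPatterns q ↑(V ⊓ LinearMap.ker p) := by
  rintro _ ⟨⟨x, ⟨hx, hpx⟩, rfl⟩, ⟨y, ⟨hy, hpy⟩, hxy⟩⟩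
  rw [sign_eq_one_iff] at hpx
  rw [sign_eq_neg_one_iff] at hpy
  refine ⟨-(p y) • x + p x • y, ⟨V.add_mem (V.smul_mem _ hx) (V.smul_mem _ hy), ?_⟩, ?_⟩
  · simp [mul_comm]
  funext i
  have hi : SignType.sign (q i y) = SignType.sign (q i x) := congrFun hxy i
  simp only [map_add, map_smul, smul_eq_mul]
  rcases lt_trichotomy (q i x) 0 with h | h | h
  · rw [sign_neg h, sign_eq_neg_one_iff] at hi ⊢
    nlinarith
  · rw [h, sign_zero, sign_eq_zero_iff] at hi ⊢
    simp [hi]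
  · rw [sign_pos h, sign_eq_one_iff] at hi ⊢
    nlinarith

lemma ncard_signPatterns_cons_le (p : Module.Dual 𝕜 E) (q : Fin M → Module.Dual 𝕜 E)
    (V : Submodule 𝕜 E) :
    (signPatterns (Fin.cons p q) V).ncard ≤
      (signPatterns q V).ncard + 2 * (signPatterns q ↑(V ⊓ LinearMap.ker p)).ncard := by
  set A : SignType → Set (Fin M → SignType) := fun σ =>
    signPatterns q {x ∈ (V : Set E) | SignType.sign (p x) = σ}
  have hsum : (signPatterns (Fin.cons p q) V).ncard ≤
      (A 0).ncard + ((A (-1)).ncard + (A 1).ncard) := by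
    refine (ncard_signPatterns_cons_le_sum p q V).trans_eq ?_
    simp [SignType.univ_eq, A]
  have hzero : A 0 = signPatterns q ↑(V ⊓ LinearMap.ker p) := by
    simp only [A, sign_eq_zero_iff]; rfl
  have hunion : (A 1 ∪ A (-1)).ncard ≤ (signPatterns q V).ncard :=
    Set.ncard_le_ncard (Set.union_subset (Set.image_mono (Set.sep_subset _ _))
      (Set.image_mono (Set.sep_subset _ _))) (Set.toFinite _)
  have hinter := Set.ncard_le_ncard (signPatterns_inter_subset p q V) (Set.toFinite _)
  have hadd := Set.ncard_union_add_ncard_inter (A 1) (A (-1))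
  rw [hzero] at hsum
  change (A 1 ∩ A (-1)).ncard ≤ _ at hinter
  omega

lemma ncard_signPatterns_le [FiniteDimensional 𝕜 E] (q : Fin M → Module.Dual 𝕜 E)
    (V : Submodule 𝕜 E) {r : ℕ} (hr : Module.finrank 𝕜 V ≤ r) :
    (signPatterns q V).ncard ≤ (2 * M + 1) ^ r := by
  induction M generalizing V r with
  | zero => exact (Set.ncard_le_one_of_subsingleton _).trans (by simp)
  | succ M ih =>
    rw [← Fin.cons_self_tail q]
    have hV := ih (Fin.tail q) V hr
    by_cases hker : V ≤ LinearMap.ker (q 0)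
    · refine ((ncard_signPatterns_cons_le_of_le_ker _ hker).trans hV).trans ?_
      gcongr; omega
    · have hlt : Module.finrank 𝕜 ↑(V ⊓ LinearMap.ker (q 0)) < Module.finrank 𝕜 V :=
        Submodule.finrank_lt_finrank_of_lt (inf_lt_left.2 hker)
      obtain ⟨r, rfl⟩ : ∃ r', r = r' + 1 := ⟨r - 1, by omega⟩
      have hW := ih (Fin.tail q) (V ⊓ LinearMap.ker (q 0)) (r := r) (by omega)
      calc (signPatterns (Fin.cons (q 0) (Fin.tail q)) V).ncard
          ≤ (2 * M + 1) ^ (r + 1) + 2 * (2 * M + 1) ^ r :=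
            (ncard_signPatterns_cons_le _ _ _).trans (add_le_add hV (Nat.mul_le_mul_left 2 hW))
        _ = (2 * M + 1) ^ r * (2 * (M + 1) + 1) := by ring
        _ ≤ (2 * (M + 1) + 1) ^ r * (2 * (M + 1) + 1) := by gcongr; omega
        _ = (2 * (M + 1) + 1) ^ (r + 1) := (pow_succ _ _).symm

end SignPatterns

lemma size_lt_size_of_two_mul_le {m k : ℕ} (hk : k ≠ 0) (h : 2 * m ≤ k) : m.size < k.size := by
  obtain ⟨r, hr⟩ := Nat.exists_eq_add_one_of_ne_zero (Nat.size_eq_zero.not.2 hk)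
  have hlt : k < 2 ^ (r + 1) := Nat.size_le.1 hr.le
  rw [hr, Nat.lt_succ_iff, Nat.size_le]
  omega

variable {n : ℕ} {Q : Set (Fin n → ℝ)} {X Y : Set (Fin n → ℝ)}

/-- The number of cells of the arrangement `{q = 0 : q ∈ Q}` that meet `X`. -/
noncomputable def cellCount (Q X : Set (Fin n → ℝ)) : ℕ :=
  (pointLocation Q '' X).ncard

/-- The number of binary digits of `cellCount Q X`, which measures the progress of the trees. -/
noncomputable def cellBits (Q X : Set (Fin n → ℝ)) : ℕ :=
  (cellCount Q X).size

lemma pointLocation_eq_iff {x y : Fin n → ℝ} :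
    pointLocation Q x = pointLocation Q y ↔
      ∀ q ∈ Q, SignType.sign (q ⬝ᵥ x) = SignType.sign (q ⬝ᵥ y) := by
  simp [funext_iff, pointLocation]

variable [Finite Q]

lemma cellCount_mono (h : X ⊆ Y) : cellCount Q X ≤ cellCount Q Y :=
  Set.ncard_le_ncard (Set.image_mono h) (Set.toFinite _)

lemma cellBits_mono (h : X ⊆ Y) : cellBits Q X ≤ cellBits Q Y :=
  Nat.size_le_size (cellCount_mono h)

lemma cellCount_eq_zero : cellCount Q X = 0 ↔ X = ∅ := by
  rw [cellCount, Set.ncard_eq_zero (Set.toFinite _), Set.image_eq_empty]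

lemma cellCount_add_le {q : Fin n → ℝ} (hq : q ∈ Q) :
    cellCount Q {x ∈ X | q ⬝ᵥ x ≤ 0} + cellCount Q {x ∈ X | 0 < q ⬝ᵥ x} ≤ cellCount Q X := by
  have hdisj : Disjoint (pointLocation Q '' {x ∈ X | q ⬝ᵥ x ≤ 0})
      (pointLocation Q '' {x ∈ X | 0 < q ⬝ᵥ x}) := by
    rw [Set.disjoint_left]
    rintro _ ⟨x, ⟨-, hx⟩, rfl⟩ ⟨y, ⟨-, hy⟩, hxy⟩
    have hsign := pointLocation_eq_iff.1 hxy q hq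
    rw [sign_pos hy, eq_comm, sign_eq_one_iff] at hsign
    exact hsign.not_ge hx
  unfold cellCount
  rw [← Set.ncard_union_eq hdisj (Set.toFinite _) (Set.toFinite _), ← Set.image_union]
  exact cellCount_mono (Set.union_subset (Set.sep_subset _ _) (Set.sep_subset _ _))

lemma cellBits_add_le {d : ℕ} (hX : X.Nonempty) (h : 2 ^ d * cellCount Q X ≤ cellCount Q Y) :
    cellBits Q X + d ≤ cellBits Q Y := by
  have hX' : cellCount Q X ≠ 0 := cellCount_eq_zero.not.2 hX.ne_empty
  rw [cellBits, cellBits, ← Nat.size_shiftLeft hX', Nat.shiftLeft_eq, mul_comm]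
  exact Nat.size_le_size h

lemma cellBits_lt_of_two_mul_le (hY : Y.Nonempty) (h : 2 * cellCount Q X ≤ cellCount Q Y) :
    cellBits Q X < cellBits Q Y :=
  size_lt_size_of_two_mul_le (cellCount_eq_zero.not.2 hY.ne_empty) h

lemma cellBits_lt_or_lt {q : Fin n → ℝ} (hq : q ∈ Q) (hX : X.Nonempty) :
    cellBits Q {x ∈ X | q ⬝ᵥ x ≤ 0} < cellBits Q X ∨
      cellBits Q {x ∈ X | 0 < q ⬝ᵥ x} < cellBits Q X := by
  have hadd := cellCount_add_le (X := X) hq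
  rcases le_total (cellCount Q {x ∈ X | q ⬝ᵥ x ≤ 0}) (cellCount Q {x ∈ X | 0 < q ⬝ᵥ x}) with h | h
  · exact .inl (cellBits_lt_of_two_mul_le hX (by omega))
  · exact .inr (cellBits_lt_of_two_mul_le hX (by omega))

lemma cellCount_le (Q X : Set (Fin n → ℝ)) [Finite Q] :
    cellCount Q X ≤ (2 * Q.ncard + 1) ^ n := by
  let e := Finite.equivFin Q
  let form : Fin (Nat.card Q) → Module.Dual ℝ (Fin n → ℝ) := fun i =>
    dotProductBilin ℝ ℝ (e.symm i : Fin n → ℝ)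
  refine (cellCount_mono X.subset_univ).trans ?_
  calc cellCount Q Set.univ
      = (signPatterns form (⊤ : Submodule ℝ (Fin n → ℝ))).ncard := by
        rw [cellCount, ← Set.ncard_image_of_injective _
          (e.arrowCongr (Equiv.refl SignType)).injective, Set.image_image]
        rfl
    _ ≤ (2 * Q.ncard + 1) ^ n := ncard_signPatterns_le _ _ (by simp)

end Cells

section Inference

section Sign

variable {G : Type*} [AddCommGroup G] [LinearOrder G] [IsOrderedAddMonoid G]

lemma sign_add_sum_nsmul {ι : Type*} {s : Finset ι} {a : G} {b : ι → G} (c : ι → ℕ)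
    (hb : ∀ i ∈ s, SignType.sign (b i) = 0 ∨ SignType.sign (b i) = SignType.sign a) :
    SignType.sign (a + ∑ i ∈ s, c i • b i) = SignType.sign a := by
  rcases lt_trichotomy a 0 with ha | rfl | ha
  · simp only [sign_neg ha, sign_eq_zero_iff, sign_eq_neg_one_iff] at hb ⊢
    exact add_neg_of_neg_of_nonpos ha <| Finset.sum_nonpos fun i hi =>
      nsmul_nonpos ((hb i hi).elim Eq.le LT.lt.le) _
  · simp only [sign_zero, sign_eq_zero_iff, or_self, zero_add] at hb ⊢
    exact Finset.sum_eq_zero fun i hi => by rw [hb i hi, smul_zero]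
  · simp only [sign_pos ha, sign_eq_zero_iff, sign_eq_one_iff] at hb ⊢
    exact add_pos_of_pos_of_nonneg ha <| Finset.sum_nonneg fun i hi =>
      nsmul_nonneg ((hb i hi).elim Eq.ge LT.lt.le) _

lemma sign_sub_of_abs_le {u v : G} (huv : SignType.sign u = SignType.sign v) (h : |u| ≤ |v|) :
    SignType.sign (v - u) = 0 ∨ SignType.sign (v - u) = SignType.sign v := by
  rcases lt_trichotomy v 0 with hv | rfl | hv
  · rw [sign_neg hv, sign_eq_neg_one_iff] at huv
    rw [abs_of_neg hv, abs_of_neg huv, neg_le_neg_iff] at h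
    rw [sign_neg hv, sign_eq_neg_one_iff, sign_eq_zero_iff, sub_neg, sub_eq_zero]
    exact h.eq_or_lt
  · simp_all [sign_eq_zero_iff]
  · rw [sign_pos hv, sign_eq_one_iff] at huv
    rw [abs_of_pos hv, abs_of_pos huv] at h
    rw [sign_pos hv, sign_eq_one_iff, sign_eq_zero_iff, sub_pos, sub_eq_zero]
    exact h.eq_or_lt.imp_left Eq.symm

end Sign

lemma exists_eq_add_sum_nsmul_sub {E : Type*} [AddCommGroup E] {v : ℕ → E} {k : ℕ} {c : ℕ → ℤ}
    (hc : ∀ i < k, |c i| ≤ 1) (hne : ∃ i < k, c i ≠ 0)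
    (hsum : ∑ i ∈ Finset.range k, c i • (v (i + 1) - v i) = 0) :
    ∃ p < k, ∃ a : ℕ → ℕ,
      v (p + 1) = v 0 + ∑ i ∈ Finset.range p, a i • (v (i + 1) - v i) := by
  induction k with
  | zero => simp at hne
  | succ k ih =>
    by_cases hk : c k = 0
    · obtain ⟨i, hi, hci⟩ := hne
      obtain ⟨p, hp, a, ha⟩ := ih (fun i hi => hc i (by omega))
        ⟨i, lt_of_le_of_ne (Nat.lt_succ_iff.1 hi) (by rintro rfl; exact hci hk), hci⟩
        (by simpa [Finset.sum_range_succ, hk] using hsum)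
      exact ⟨p, by omega, a, ha⟩
    · clear ih hne
      wlog hk1 : c k = 1 generalizing c
      · have hle := abs_le.1 (hc k k.lt_succ_self)
        exact this (c := -c) (by simpa using hc) (by simpa using hsum) (by simpa using hk)
          (by simp only [Pi.neg_apply]; omega)
      refine ⟨k, k.lt_succ_self, fun i => (1 - c i).toNat, ?_⟩
      have hcoe : ∀ i ∈ Finset.range k, (1 - c i).toNat • (v (i + 1) - v i) =
          (v (i + 1) - v i) - c i • (v (i + 1) - v i) := fun i hi => by
        have hle := abs_le.1 (hc i (by simp at hi; omega))
        rw [← natCast_zsmul, Int.toNat_of_nonneg (by omega), sub_smul, one_smul]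
      rw [Finset.sum_range_succ, hk1, one_smul, ← eq_neg_iff_add_eq_zero] at hsum
      rw [Finset.sum_congr rfl hcoe, Finset.sum_sub_distrib, Finset.sum_range_sub, hsum]
      abel

open Matrix in
lemma exists_mulVec_eq_zero_of_abs_le_one {α β : Type*} [Fintype α] [Fintype β] [Nonempty α]
    (hlt : Fintype.card α < Fintype.card β)
    (hpow : Fintype.card β ^ Fintype.card α < 2 ^ (Fintype.card β - Fintype.card α))
    {A : Matrix α β ℤ} (hA : ∀ i j, |A i j| ≤ 1) :
    ∃ t : β → ℤ, t ≠ 0 ∧ A *ᵥ t = 0 ∧ ∀ j, |t j| ≤ 1 := by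
  set m := Fintype.card α
  set k := Fintype.card β
  obtain ⟨t, ht, hAt, hnorm⟩ :=
    Int.Matrix.exists_ne_zero_int_vec_norm_le A hlt Fintype.card_pos
  refine ⟨t, ht, hAt, fun j => ?_⟩
  have hsub : (0 : ℝ) < k - m := sub_pos.2 (mod_cast hlt)
  let : SeminormedAddCommGroup (Matrix α β ℤ) := Matrix.seminormedAddCommGroup
  have hAnorm : max 1 ‖A‖ = 1 := max_eq_left <|
    (Matrix.norm_le_iff zero_le_one).2 fun i j => by
      rw [Int.norm_eq_abs]; exact mod_cast hA i j
  have hlt_two : ((k : ℝ) * max 1 ‖A‖) ^ ((m : ℝ) / (k - m)) < 2 := by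
    rw [hAnorm, mul_one, div_eq_mul_inv, Real.rpow_mul (Nat.cast_nonneg _), Real.rpow_natCast,
      Real.rpow_inv_lt_iff_of_pos (by positivity) zero_le_two hsub, ← Nat.cast_sub hlt.le,
      Real.rpow_natCast]
    exact mod_cast hpow
  have habs : ‖t j‖ < 2 := ((norm_le_pi_norm t j).trans hnorm).trans_lt hlt_two
  rw [Int.norm_eq_abs] at habs
  have habs' : |t j| < 2 := mod_cast habs
  omega

lemma exists_monotone_enumeration {α β : Type*} [LinearOrder β] (f : α → β) {D : Finset α} {k : ℕ}
    (hD : D.card = k + 1) :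
    ∃ w : ℕ → α, (∀ i, w i ∈ D) ∧ Set.InjOn w (Set.Iic k) ∧ Monotone (f ∘ w) := by
  let e : Fin (k + 1) ≃ D := (D.equivFinOfCardEq hD).symm
  let σ : Equiv.Perm (Fin (k + 1)) := Tuple.sort fun i => f (e i)
  let clamp : ℕ → Fin (k + 1) := fun i => ⟨min i k, by omega⟩
  have clamp_mono : Monotone clamp := fun i j hij => Fin.mk_le_mk.2 (min_le_min_right k hij)
  refine ⟨fun i => e (σ (clamp i)), fun i => (e _).2, fun i hi j hj hij => ?_,
    (Tuple.monotone_sort fun i => f (e i)).comp clamp_mono⟩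
  have hclamp := Fin.mk.inj_iff.1 (σ.injective (e.injective (Subtype.val_injective hij)))
  rwa [min_eq_left hi, min_eq_left hj] at hclamp

variable {n : ℕ} {S T H : Set (Fin n → ℝ)} {x y h : Fin n → ℝ} {d k : ℕ}

/-- The label queries and the comparison queries of `S`. -/
def comparisonQueries (S : Set (Fin n → ℝ)) : Set (Fin n → ℝ) :=
  S ∪ (S - S)

lemma comparisonQueries_mono (hST : S ⊆ T) : comparisonQueries S ⊆ comparisonQueries T :=
  Set.union_subset_union hST (Set.sub_subset_sub hST hST)

instance [Finite S] : Finite (comparisonQueries S) :=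
  (S.toFinite.union (S.toFinite.sub S.toFinite)).to_subtype

/-- `S` infers `h` at `x` if the answers to the queries of `S` on input `x` determine the sign of
`⟨h, x⟩`. -/
def Infers (S : Set (Fin n → ℝ)) (x h : Fin n → ℝ) : Prop :=
  ∀ y, pointLocation (comparisonQueries S) y = pointLocation (comparisonQueries S) x →
    SignType.sign (h ⬝ᵥ y) = SignType.sign (h ⬝ᵥ x)

lemma Infers.mono (hST : S ⊆ T) (hS : Infers S x h) : Infers T x h := fun y hy =>
  hS y <| pointLocation_eq_iff.2 fun q hq =>
    pointLocation_eq_iff.1 hy q (comparisonQueries_mono hST hq)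

lemma Infers.of_mem (hh : h ∈ S) : Infers S x h := fun _ hy =>
  pointLocation_eq_iff.1 hy h (.inl hh)

/-- The inference dimension of `H` is at most `d`: at every input, some element of any `d` elements
of `H` is inferred by the others. -/
def InferenceDimLE (H : Set (Fin n → ℝ)) (d : ℕ) : Prop :=
  ∀ x, ∀ D : Finset (Fin n → ℝ), ↑D ⊆ H → d ≤ D.card → ∃ h ∈ D, Infers (↑D \ {h}) x h

lemma InferenceDimLE.pos (hdim : InferenceDimLE H d) : 0 < d := by
  by_contra! hd
  obtain ⟨h, hh, -⟩ := hdim 0 ∅ (by simp) (by simpa using hd)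
  exact Finset.notMem_empty h hh

lemma exists_eq_add_sum_nsmul_sub_of_zero_one (hn : 0 < n) (hnk : n < k)
    (hk : k ^ n < 2 ^ (k - n)) {g : ℕ → Fin n → ℝ} (hg : ∀ i j, g i j = 0 ∨ g i j = 1) :
    ∃ p < k, ∃ a : ℕ → ℕ,
      g (p + 1) = g 0 + ∑ i ∈ Finset.range p, a i • (g (i + 1) - g i) := by
  have : Nonempty (Fin n) := ⟨⟨0, hn⟩⟩
  have integral : ∀ i j, ∃ z : ℤ, (z = 0 ∨ z = 1) ∧ z = g i j := fun i j =>
    (hg i j).elim (fun h => ⟨0, by simp [h]⟩) fun h => ⟨1, by simp [h]⟩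
  choose z hz hzg using integral
  let A : Matrix (Fin n) (Fin k) ℤ := Matrix.of fun j i => z (i + 1) j - z i j
  obtain ⟨t, ht, hAt, ht1⟩ := exists_mulVec_eq_zero_of_abs_le_one (A := A) (by simpa) (by simpa)
    fun j i => by
      rcases hz (i + 1) j with h | h <;> rcases hz i j with h' | h' <;> simp [A, h, h']
  let c : ℕ → ℤ := fun i => if hi : i < k then t ⟨i, hi⟩ else 0
  obtain ⟨i, hi⟩ := Function.ne_iff.1 ht
  refine exists_eq_add_sum_nsmul_sub (c := c) (fun i hi => by simpa [c, hi] using ht1 _)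
    ⟨i, i.2, by simpa [c] using hi⟩ (funext fun j => ?_)
  have hj : (∑ i : Fin k, (z (i + 1) j - z i j) * t i : ℤ) = 0 := congrFun hAt j
  rw [Finset.sum_range]
  simp only [c, Fin.is_lt, dite_true, Finset.sum_apply, Pi.smul_apply, Pi.sub_apply, ← hzg,
    Pi.zero_apply]
  simp only [zsmul_eq_mul, mul_comm (Int.cast _ : ℝ)]
  exact_mod_cast hj

lemma exists_infers_of_chain (hn : 0 < n) (hnk : n < k) (hk : k ^ n < 2 ^ (k - n))
    {g : ℕ → Fin n → ℝ} (hg : ∀ i j, g i j = 0 ∨ g i j = 1) {σ : SignType}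
    (hσ : ∀ i, SignType.sign (g i ⬝ᵥ x) = σ) (habs : Monotone fun i => |g i ⬝ᵥ x|) :
    ∃ p < k, Infers (g '' Set.Iic p) x (g (p + 1)) := by
  obtain ⟨p, hp, a, heq⟩ := exists_eq_add_sum_nsmul_sub_of_zero_one hn hnk hk hg
  refine ⟨p, hp, fun y hy => ?_⟩
  rw [pointLocation_eq_iff] at hy
  have mem : ∀ i ≤ p, g i ∈ g '' Set.Iic p := fun i hi => ⟨i, hi, rfl⟩
  have hy0 : SignType.sign (g 0 ⬝ᵥ y) = σ := (hy _ (.inl (mem 0 p.zero_le))).trans (hσ 0)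
  rw [hσ, heq, add_dotProduct, sum_dotProduct]
  simp only [smul_dotProduct]
  refine (sign_add_sum_nsmul a fun i hi => ?_).trans hy0
  have hi : i < p := Finset.mem_range.1 hi
  rw [hy _ (.inr (Set.sub_mem_sub (mem _ hi) (mem _ hi.le))), sub_dotProduct, hy0, ← hσ (i + 1)]
  exact sign_sub_of_abs_le (by rw [hσ, hσ]) (habs i.le_succ)

lemma inferenceDimLE_of_zero_one (hn : 0 < n) (hnk : n < k) (hk : k ^ n < 2 ^ (k - n))
    (hH : ∀ h ∈ H, ∀ j, h j = 0 ∨ h j = 1) : InferenceDimLE H (3 * (k + 1)) := by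
  intro x D hDH hcard
  obtain ⟨σ, -, hσ⟩ := Finset.exists_le_card_fiber_of_mul_le_card_of_maps_to
    (t := (Finset.univ : Finset SignType)) (f := fun h => SignType.sign (h ⬝ᵥ x))
    (fun _ _ => Finset.mem_univ _) Finset.univ_nonempty hcard
  obtain ⟨D', hD', hcard'⟩ := Finset.exists_subset_card_eq hσ
  obtain ⟨g, hgD', hinj, hmono⟩ := exists_monotone_enumeration (fun h => |h ⬝ᵥ x|) hcard'
  have hgD : ∀ i, g i ∈ D ∧ SignType.sign (g i ⬝ᵥ x) = σ := fun i =>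
    Finset.mem_filter.1 (hD' (hgD' i))
  obtain ⟨p, hp, hinf⟩ := exists_infers_of_chain hn hnk hk (fun i => hH _ (hDH (hgD i).1))
    (fun i => (hgD i).2) hmono
  refine ⟨g (p + 1), (hgD _).1, hinf.mono ?_⟩
  rintro _ ⟨i, hi : i ≤ p, rfl⟩
  refine ⟨(hgD i).1, fun heq => ?_⟩
  have := hinj (hi.trans hp.le) (Nat.succ_le_of_lt hp) heq
  omega

end Inference

section Trees

namespace LinearDecisionTree

/-- Relabel the leaves of a tree. -/
def mapLeaves {n : ℕ} {α β : Type} (f : α → β) :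
    LinearDecisionTree n α → LinearDecisionTree n β
  | leaf a => leaf (f a)
  | query h next => query h fun s => mapLeaves f (next s)

variable {n : ℕ} {α β : Type}

lemma eval_mapLeaves (f : α → β) (T : LinearDecisionTree n α) (x : Fin n → ℝ) :
    (T.mapLeaves f).eval x = f (T.eval x) := by
  induction T with
  | leaf a => rfl
  | query h _ ih => exact ih _

lemma depth_mapLeaves (f : α → β) (T : LinearDecisionTree n α) :
    (T.mapLeaves f).depth = T.depth := by
  induction T with
  | leaf a => rfl
  | query h _ ih => simp only [mapLeaves, depth, ih]

lemma queries_mapLeaves (f : α → β) (T : LinearDecisionTree n α) :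
    (T.mapLeaves f).queries = T.queries := by
  induction T with
  | leaf a => rfl
  | query h _ ih => simp only [mapLeaves, queries, ih]

end LinearDecisionTree

variable {n k l : ℕ} {β γ : Type} {f : (Fin n → ℝ) → β} {H X Y : Set (Fin n → ℝ)}
  {q q' x₀ : Fin n → ℝ}

/-- Some comparison decision tree for `H` of depth at most `k` computes `f` on `X`. -/
def ComputableWithin (H : Set (Fin n → ℝ)) (f : (Fin n → ℝ) → β) (X : Set (Fin n → ℝ)) (k : ℕ) :
    Prop :=
  ∃ T : LinearDecisionTree n β, (∀ x ∈ X, T.eval x = f x) ∧ T.IsComparison H ∧ T.depth ≤ k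

namespace ComputableWithin

lemma mono (h : ComputableWithin H f X k) (hYX : Y ⊆ X) (hkl : k ≤ l) :
    ComputableWithin H f Y l :=
  let ⟨T, hT, hTH, hTk⟩ := h
  ⟨T, fun x hx => hT x (hYX hx), hTH, hTk.trans hkl⟩

lemma comp (h : ComputableWithin H f X k) (g : β → γ) : ComputableWithin H (g ∘ f) X k :=
  let ⟨T, hT, hTH, hTk⟩ := h
  ⟨T.mapLeaves g, fun x hx => by rw [T.eval_mapLeaves, hT x hx, Function.comp_apply],
    (T.queries_mapLeaves g).trans_subset hTH, (T.depth_mapLeaves g).trans_le hTk⟩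

lemma of_forall_eq (b : β) (h : ∀ x ∈ X, f x = b) : ComputableWithin H f X k :=
  ⟨.leaf b, fun x hx => (h x hx).symm, Set.empty_subset _, Nat.zero_le _⟩

lemma empty [Nonempty β] : ComputableWithin H f ∅ k :=
  of_forall_eq (Classical.arbitrary β) (by simp)

lemma query (hq : q ∈ comparisonQueries H) (hneg : ComputableWithin H f {x ∈ X | q ⬝ᵥ x < 0} k)
    (hzero : ComputableWithin H f {x ∈ X | q ⬝ᵥ x = 0} k)
    (hpos : ComputableWithin H f {x ∈ X | 0 < q ⬝ᵥ x} k) : ComputableWithin H f X (k + 1) := by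
  have branch : ∀ σ, ComputableWithin H f {x ∈ X | SignType.sign (q ⬝ᵥ x) = σ} k := by
    rintro (_ | _ | _)
    · exact hzero.mono (fun x hx => ⟨hx.1, sign_eq_zero_iff.1 hx.2⟩) le_rfl
    · exact hneg.mono (fun x hx => ⟨hx.1, sign_eq_neg_one_iff.1 hx.2⟩) le_rfl
    · exact hpos.mono (fun x hx => ⟨hx.1, sign_eq_one_iff.1 hx.2⟩) le_rfl
  choose T hT hTH hTk using branch
  refine ⟨.query q T, fun x hx => hT _ x ⟨hx, rfl⟩, ?_, ?_⟩
  · exact Set.union_subset (Set.singleton_subset_iff.2 hq) (Set.iUnion_subset hTH)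
  · rw [LinearDecisionTree.depth, add_comm]
    exact Nat.succ_le_succ (Finset.sup_le fun σ _ => hTk σ)

end ComputableWithin

/-- The sign of `⟨q, x⟩` is the same for all `x ∈ X`. -/
def SignConstOn (q : Fin n → ℝ) (X : Set (Fin n → ℝ)) : Prop :=
  ∀ x ∈ X, ∀ y ∈ X, SignType.sign (q ⬝ᵥ x) = SignType.sign (q ⬝ᵥ y)

namespace SignConstOn

lemma mono (h : SignConstOn q X) (hYX : Y ⊆ X) : SignConstOn q Y :=
  fun x hx y hy => h x (hYX hx) y (hYX hy)

lemma neg (h : SignConstOn q X) : SignConstOn (-q) X := fun x hx y hy => by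
  rw [neg_dotProduct, neg_dotProduct, Left.sign_neg, Left.sign_neg, h x hx y hy]

lemma of_forall_pos (h : ∀ x ∈ X, 0 < q ⬝ᵥ x) : SignConstOn q X :=
  fun x hx y hy => by rw [sign_pos (h x hx), sign_pos (h y hy)]

lemma of_forall_neg (h : ∀ x ∈ X, q ⬝ᵥ x < 0) : SignConstOn q X :=
  fun x hx y hy => by rw [sign_neg (h x hx), sign_neg (h y hy)]

lemma of_sub_of_forall_eq_zero (h : SignConstOn (q - q') X) (h0 : ∀ x ∈ X, q' ⬝ᵥ x = 0) :
    SignConstOn q X := fun x hx y hy => by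
  simpa only [sub_dotProduct, h0 x hx, h0 y hy, sub_zero] using h x hx y hy

lemma dotProduct_le (h : SignConstOn (q - q') X) (hx₀ : x₀ ∈ X) (hle : q ⬝ᵥ x₀ ≤ q' ⬝ᵥ x₀) :
    ∀ x ∈ X, q ⬝ᵥ x ≤ q' ⬝ᵥ x := by
  intro x hx
  by_contra! hlt
  have hsign := h x₀ hx₀ x hx
  rw [sub_dotProduct, sub_dotProduct, sign_pos (sub_pos.2 hlt), sign_eq_one_iff] at hsign
  exact (sub_pos.1 hsign).not_ge hle

end SignConstOn

section Search

variable {D : Set (Fin n → ℝ)}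

lemma computableWithin_of_forall_neg_or [Nonempty β] (hDfin : D.Finite)
    (hDH : D ⊆ comparisonQueries H) (hchain : ∀ q ∈ D, ∀ q' ∈ D, SignConstOn (q - q') X)
    (hresolved : ∀ Y ⊆ X, (∀ q ∈ D, SignConstOn q Y) → ComputableWithin H f Y k)
    (hneg : ∀ q ∈ D, (∀ x ∈ X, q ⬝ᵥ x < 0) ∨ ComputableWithin H f {x ∈ X | q ⬝ᵥ x < 0} k) :
    ComputableWithin H f X (k + 1) := by
  rcases X.eq_empty_or_nonempty with rfl | ⟨x₀, hx₀⟩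
  · exact .empty
  rcases {q ∈ D | ¬ ∀ x ∈ X, q ⬝ᵥ x < 0}.eq_empty_or_nonempty with hD | hD
  · refine (hresolved X subset_rfl fun q hq => .of_forall_neg ?_).mono subset_rfl k.le_succ
    by_contra hq'
    exact hD.subset ⟨hq, hq'⟩
  obtain ⟨q, ⟨hq, hqX⟩, hmin⟩ :=
    Set.exists_min_image _ (fun q => q ⬝ᵥ x₀) (hDfin.subset (Set.sep_subset _ _)) hD
  refine .query (hDH hq) ((hneg q hq).resolve_left hqX) ?_ ?_ <;>
    refine hresolved _ (Set.sep_subset _ _) fun q' hq' => ?_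
  · exact ((hchain q' hq' q hq).mono (Set.sep_subset _ _)).of_sub_of_forall_eq_zero fun x hx => hx.2
  · by_cases hq'X : ∀ x ∈ X, q' ⬝ᵥ x < 0
    · exact .of_forall_neg fun x hx => hq'X x hx.1
    · exact .of_forall_pos fun x hx => hx.2.trans_le <|
        (hchain q hq q' hq').dotProduct_le hx₀ (hmin q' ⟨hq', hq'X⟩) x hx.1

lemma computableWithin_of_forall_neg_or_pos [Nonempty β] (hDfin : D.Finite)
    (hDH : D ⊆ comparisonQueries H) (hchain : ∀ q ∈ D, ∀ q' ∈ D, SignConstOn (q - q') X)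
    (hresolved : ∀ Y ⊆ X, (∀ q ∈ D, SignConstOn q Y) → ComputableWithin H f Y k)
    (hbranch : ∀ q ∈ D, ComputableWithin H f {x ∈ X | q ⬝ᵥ x < 0} k ∨
      ComputableWithin H f {x ∈ X | 0 < q ⬝ᵥ x} k) :
    ComputableWithin H f X (k + 2) := by
  rcases X.eq_empty_or_nonempty with rfl | ⟨x₀, hx₀⟩
  · exact .empty
  set heavy : Set (Fin n → ℝ) := {q ∈ D | ¬ ComputableWithin H f {x ∈ X | q ⬝ᵥ x < 0} k}
  rcases heavy.eq_empty_or_nonempty with hheavy | hheavy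
  · refine (computableWithin_of_forall_neg_or hDfin hDH hchain hresolved fun q hq => .inr ?_).mono
      subset_rfl (k + 1).le_succ
    by_contra hq'
    exact hheavy.subset ⟨hq, hq'⟩
  obtain ⟨q, ⟨hq, hqX⟩, hmax⟩ :=
    Set.exists_max_image _ (fun q => q ⬝ᵥ x₀) (hDfin.subset (Set.sep_subset _ _)) hheavy
  have hsub : {x ∈ X | q ⬝ᵥ x < 0} ⊆ X := Set.sep_subset _ _
  refine .query (hDH hq) ?_ ?_ ?_
  · refine computableWithin_of_forall_neg_or hDfin hDH
      (fun q hq q' hq' => (hchain q hq q' hq').mono hsub)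
      (fun Y hY => hresolved Y (hY.trans hsub)) fun q' hq' => ?_
    by_cases hq'X : ComputableWithin H f {x ∈ X | q' ⬝ᵥ x < 0} k
    · exact .inr (hq'X.mono (fun x hx => ⟨hx.1.1, hx.2⟩) le_rfl)
    · exact .inl fun x hx => lt_of_le_of_lt
        ((hchain q' hq' q hq).dotProduct_le hx₀ (hmax q' ⟨hq', hq'X⟩) x hx.1) hx.2
  · refine (hresolved _ (Set.sep_subset _ _) fun q' hq' => ?_).mono subset_rfl k.le_succ
    exact ((hchain q' hq' q hq).mono (Set.sep_subset _ _)).of_sub_of_forall_eq_zero fun x hx => hx.2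
  · exact ((hbranch q hq).resolve_left hqX).mono subset_rfl k.le_succ

/-- Weighted binary search: all but two of the queries along a branch are paid for by a halving of
the number of cells. -/
lemma computableWithin_of_chain [Nonempty β] [Finite H] {a : ℕ} (hDfin : D.Finite)
    (hDH : D ⊆ comparisonQueries H) (hchain : ∀ q ∈ D, ∀ q' ∈ D, SignConstOn (q - q') X)
    (hresolved : ∀ Y ⊆ X, (∀ q ∈ D, SignConstOn q Y) →
      ComputableWithin H f Y (a + 2 * cellBits (comparisonQueries H) Y)) :
    ComputableWithin H f X (a + 2 * cellBits (comparisonQueries H) X + 2) := by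
  induction hb : cellBits (comparisonQueries H) X using Nat.strong_induction_on generalizing X with
  | _ b ih =>
  subst hb
  rcases X.eq_empty_or_nonempty with rfl | hX
  · exact .empty
  have light : ∀ Y ⊆ X, cellBits (comparisonQueries H) Y < cellBits (comparisonQueries H) X →
      ComputableWithin H f Y (a + 2 * cellBits (comparisonQueries H) X) := fun Y hY hlt =>
    (ih _ hlt (fun q hq q' hq' => (hchain q hq q' hq').mono hY)
      (fun Z hZ => hresolved Z (hZ.trans hY)) rfl).mono subset_rfl (by omega)
  refine computableWithin_of_forall_neg_or_pos hDfin hDH hchain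
    (fun Y hY hconst => (hresolved Y hY hconst).mono subset_rfl ?_) fun q hq => ?_
  · have := cellBits_mono (Q := comparisonQueries H) hY
    omega
  · refine (cellBits_lt_or_lt (hDH hq) hX).imp (fun hlt => ?_) fun hlt => ?_
    · exact (light _ (Set.sep_subset _ _) hlt).mono (fun x hx => ⟨hx.1, hx.2.le⟩) le_rfl
    · exact light _ (Set.sep_subset _ _) hlt

end Search

/-- The forms in `S`, together with `0`, are ordered in the same way at all points of `X`; in other
words, the sorting problem for `S` is solved on `X`. -/
def OrderConstOn (S X : Set (Fin n → ℝ)) : Prop :=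
  ∀ t ∈ insert 0 S, ∀ t' ∈ insert 0 S, SignConstOn (t - t') X

namespace OrderConstOn

variable {S : Set (Fin n → ℝ)} {h : Fin n → ℝ}

lemma pointLocation_eq (hS : OrderConstOn S X) {x y : Fin n → ℝ} (hx : x ∈ X) (hy : y ∈ X) :
    pointLocation (comparisonQueries S) x = pointLocation (comparisonQueries S) y := by
  rw [pointLocation_eq_iff]
  rintro q (hq | ⟨t, ht, t', ht', rfl⟩)
  · simpa using hS q (.inr hq) 0 (.inl rfl) x hx y hy
  · exact hS t (.inr ht) t' (.inr ht') x hx y hy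

lemma insert (hS : OrderConstOn S X) (hh : ∀ t ∈ insert 0 S, SignConstOn (h - t) X) :
    OrderConstOn (insert h S) X := by
  intro t ht t' ht'
  rw [Set.insert_comm, Set.mem_insert_iff] at ht ht'
  rcases ht with rfl | ht <;> rcases ht' with rfl | ht'
  · simp [SignConstOn]
  · exact hh t' ht'
  · simpa using (hh t ht).neg
  · exact hS t ht t' ht'

end OrderConstOn

lemma computableWithin_of_sort [Nonempty β] [Finite H] {a : ℕ} {S : Finset (Fin n → ℝ)}
    (hSH : ↑S ⊆ H)
    (hsorted : ∀ Y ⊆ X, OrderConstOn S Y →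
      ComputableWithin H f Y (a + 2 * cellBits (comparisonQueries H) Y)) :
    ComputableWithin H f X (a + 2 * S.card + 2 * cellBits (comparisonQueries H) X) := by
  classical
  induction S using Finset.induction_on generalizing a with
  | empty => simpa using hsorted X subset_rfl (by simp [OrderConstOn, SignConstOn])
  | insert h S hh ih =>
    rw [Finset.coe_insert, Set.insert_subset_iff] at hSH
    obtain ⟨hhH, hSH⟩ := hSH
    rw [Finset.card_insert_of_notMem hh]
    refine (ih (a := a + 2) hSH fun Y hY hSY => ?_).mono subset_rfl (by omega)
    refine (computableWithin_of_chain (D := (h - ·) '' insert 0 ↑S) (a := a)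
      ((S.finite_toSet.insert 0).image _) ?_ ?_ fun Z hZ hD => ?_).mono subset_rfl (by omega)
    · rintro _ ⟨t, rfl | ht, rfl⟩
      · exact .inl (by simpa using hhH)
      · exact .inr (Set.sub_mem_sub hhH (hSH ht))
    · rintro _ ⟨t, ht, rfl⟩ _ ⟨t', ht', rfl⟩
      simpa using hSY t' ht' t ht
    · refine hsorted Z (hZ.trans hY) ?_
      rw [Finset.coe_insert]
      exact OrderConstOn.insert (fun t ht t' ht' => (hSY t ht t' ht').mono hZ)
        fun t ht => hD _ ⟨t, ht, rfl⟩

end Trees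

section Rounds

variable {n d a : ℕ} {β : Type} {f : (Fin n → ℝ) → β} {H S X : Set (Fin n → ℝ)}
  {R : Finset (Fin n → ℝ)} {x y h : Fin n → ℝ}

lemma InferenceDimLE.isInferenceRel (hdim : InferenceDimLE H d) (hRH : ↑R ⊆ H) (x : Fin n → ℝ) :
    IsInferenceRel (fun T h => Infers T x h) R d where
  mono := Infers.mono
  of_mem := Infers.of_mem
  exists_of_le_card D hD := hdim x D ((Finset.coe_subset.2 hD).trans hRH)

lemma infers_congr
    (hxy : pointLocation (comparisonQueries S) x = pointLocation (comparisonQueries S) y) :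
    Infers S x h ↔ Infers S y h := by
  have transfer : ∀ {x y}, pointLocation (comparisonQueries S) x =
      pointLocation (comparisonQueries S) y → Infers S x h → Infers S y h := fun hxy hx z hz =>
    (hx z (hz.trans hxy.symm)).trans (hx _ hxy.symm).symm
  exact ⟨transfer hxy, transfer hxy.symm⟩

lemma uninferred_congr
    (hxy : pointLocation (comparisonQueries S) x = pointLocation (comparisonQueries S) y) :
    uninferred (fun T h => Infers T x h) R S = uninferred (fun T h => Infers T y h) R S := by
  classical exact Finset.filter_congr fun _ _ => not_congr (infers_congr hxy)

/-- The inputs at which the sample `S` leaves more than half of `R` uninferred. -/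
def poorInputs (R : Finset (Fin n → ℝ)) (S : Set (Fin n → ℝ)) : Set (Fin n → ℝ) :=
  {x | IsPoor (fun T h => Infers T x h) R S}

lemma mem_poorInputs_congr
    (hxy : pointLocation (comparisonQueries S) x = pointLocation (comparisonQueries S) y) :
    x ∈ poorInputs R S ↔ y ∈ poorInputs R S := by
  simp only [poorInputs, IsPoor, Set.mem_ofPred_eq, uninferred_congr hxy]

lemma InferenceDimLE.exists_sample [Finite H] (hdim : InferenceDimLE H d) (hRH : ↑R ⊆ H)
    (hR : R.Nonempty) (X : Set (Fin n → ℝ)) :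
    ∃ S ⊆ R, S.card ≤ 20 * d ∧
      2 ^ d * cellCount (comparisonQueries H) (X ∩ poorInputs R S) ≤
        cellCount (comparisonQueries H) X := by
  classical
  obtain ⟨C, hCX, hC⟩ := Set.exists_subset_bijOn X (pointLocation (comparisonQueries H))
  have : Finite C := Set.Finite.of_finite_image (Set.toFinite _) hC.injOn
  lift C to Finset (Fin n → ℝ) using C.toFinite
  obtain ⟨w, hw, hpoor⟩ := exists_sample_forall_isInferenceRel (C := C)
    (I := fun x T h => Infers T x h) (fun x _ => hdim.isInferenceRel hRH x) hR
  have hSR : Finset.univ.image w ⊆ R :=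
    Finset.image_subset_iff.2 fun i _ => Fintype.mem_piFinset.1 hw i
  refine ⟨Finset.univ.image w, hSR, Finset.card_image_le.trans (by simp), ?_⟩
  rw [Finset.coe_image, Finset.coe_univ, Set.image_univ]
  have hcells : cellCount (comparisonQueries H) X = C.card := by
    rw [cellCount, ← hC.image_eq, hC.injOn.ncard_image, Set.ncard_coe_finset]
  have hpoor_cells : cellCount (comparisonQueries H) (X ∩ poorInputs R (Set.range w)) ≤
      {c ∈ C | IsPoor (fun T h => Infers T c h) R (Set.range w)}.card := by
    rw [← Set.ncard_coe_finset]
    refine (Set.ncard_le_ncard ?_ (Set.toFinite _)).trans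
      (Set.ncard_image_le (f := pointLocation (comparisonQueries H)) (Set.toFinite _))
    rintro _ ⟨x, ⟨hx, hxpoor⟩, rfl⟩
    obtain ⟨c, hc, hcx⟩ := hC.surjOn ⟨x, hx, rfl⟩
    refine ⟨c, Finset.mem_coe.2 (Finset.mem_filter.2 ⟨hc, ?_⟩), hcx⟩
    refine (mem_poorInputs_congr (pointLocation_eq_iff.2 fun q hq => ?_)).2 hxpoor
    refine pointLocation_eq_iff.1 hcx q (comparisonQueries_mono ?_ hq)
    exact (Set.range_subset_iff.2 (Fintype.mem_piFinset.1 hw)).trans hRH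
  exact hcells ▸ (Nat.mul_le_mul_left _ hpoor_cells).trans hpoor

lemma OrderConstOn.signConstOn_of_infers (hS : OrderConstOn S X) (hx : x ∈ X)
    (hinf : Infers S x h) : SignConstOn h X := fun y hy z hz => by
  rw [hinf y (hS.pointLocation_eq hy hx), hinf z (hS.pointLocation_eq hz hx)]

/-- One round: sort a sample `S` of the set `R` of unresolved forms. A leaf at which `S` is rich
halves `R`, and the leaves at which `S` is poor retain at most a fraction `2⁻ᵈ` of the cells, so
that the weight `d * R.card.size + cellBits (comparisonQueries H) X` drops by `d` in either case. -/
lemma InferenceDimLE.computableWithin_of_round [Nonempty β] [Finite H]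
    (hdim : InferenceDimLE H d) (hRH : ↑R ⊆ H) (hR : R.Nonempty)
    (hconst : ∀ h ∈ H, h ∉ R → SignConstOn h X)
    (hrec : ∀ Y ⊆ X, ∀ R' : Finset (Fin n → ℝ), ↑R' ⊆ H → (∀ h ∈ H, h ∉ R' → SignConstOn h Y) →
      d * R'.card.size + cellBits (comparisonQueries H) Y + d ≤
        d * R.card.size + cellBits (comparisonQueries H) X →
      ComputableWithin H f Y (a + 2 * cellBits (comparisonQueries H) Y)) :
    ComputableWithin H f X (a + 40 * d + 2 * cellBits (comparisonQueries H) X) := by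
  obtain ⟨S, hSR, hS, hpoor⟩ := hdim.exists_sample hRH hR X
  refine (computableWithin_of_sort (a := a) ((Finset.coe_subset.2 hSR).trans hRH)
    fun Y hYX hYS => ?_).mono subset_rfl (by omega)
  rcases Y.eq_empty_or_nonempty with rfl | ⟨y, hy⟩
  · exact .empty
  by_cases hy_poor : y ∈ poorInputs R S
  · have hY_poor : Y ⊆ X ∩ poorInputs R S := fun z hz =>
      ⟨hYX hz, (mem_poorInputs_congr (hYS.pointLocation_eq hz hy)).2 hy_poor⟩
    have hbits := cellBits_add_le ⟨y, hy⟩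
      ((Nat.mul_le_mul_left (2 ^ d) (cellCount_mono hY_poor)).trans hpoor)
    exact hrec Y hYX R hRH (fun h hh hhR => (hconst h hh hhR).mono hYX) (by omega)
  · set U := uninferred (fun T h => Infers T y h) R S
    have hUR : U ⊆ R := uninferred_subset
    have hsize : U.card.size + 1 ≤ R.card.size :=
      size_lt_size_of_two_mul_le hR.card_pos.ne' (not_lt.1 hy_poor)
    have hbits := cellBits_mono (Q := comparisonQueries H) hYX
    refine hrec Y hYX U ((Finset.coe_subset.2 hUR).trans hRH) (fun h hh hhU => ?_) ?_
    · by_cases hhR : h ∈ R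
      · exact hYS.signConstOn_of_infers hy (by simpa [U, uninferred, hhR] using hhU)
      · exact (hconst h hh hhR).mono hYX
    · linarith [Nat.mul_le_mul_left d hsize]

lemma InferenceDimLE.computableWithin_pointLocation_of_signConstOn [Finite H]
    (hdim : InferenceDimLE H d) (hRH : ↑R ⊆ H) (hconst : ∀ h ∈ H, h ∉ R → SignConstOn h X) :
    ComputableWithin H (pointLocation H) X
      (40 * (d * R.card.size + cellBits (comparisonQueries H) X) +
        2 * cellBits (comparisonQueries H) X) := by
  induction hV : d * R.card.size + cellBits (comparisonQueries H) X
    using Nat.strong_induction_on generalizing X R with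
  | _ V ih =>
  rcases R.eq_empty_or_nonempty with rfl | hR
  · rcases X.eq_empty_or_nonempty with rfl | ⟨x₀, hx₀⟩
    · exact .empty
    · exact .of_forall_eq (pointLocation H x₀) fun x hx =>
        pointLocation_eq_iff.2 fun h hh => hconst h hh (by simp) x hx x₀ hx₀
  have hd := hdim.pos
  have hdV : d ≤ V :=
    hV ▸ (Nat.le_mul_of_pos_right d (Nat.size_pos.2 hR.card_pos)).trans (Nat.le_add_right _ _)
  exact (hdim.computableWithin_of_round (a := 40 * (V - d)) hRH hR hconst
    fun Y _ R' hR' hconst' hle => (ih _ (by omega) hR' hconst' rfl).mono subset_rfl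
      (by omega)).mono subset_rfl (by omega)

theorem InferenceDimLE.computableWithin_pointLocation [Finite H] (hdim : InferenceDimLE H d) :
    ComputableWithin H (pointLocation H) Set.univ
      (40 * (d * H.ncard.size + cellBits (comparisonQueries H) Set.univ) +
        2 * cellBits (comparisonQueries H) Set.univ) := by
  have hfin := H.toFinite
  rw [Set.ncard_eq_toFinset_card H hfin]
  exact hdim.computableWithin_pointLocation_of_signConstOn (by simp) fun h hh hh' =>
    absurd (hfin.mem_toFinset.2 hh) hh'

end Rounds

section SubsetSum

variable {n : ℕ}

lemma ncard_le_card_pow {α : Type*} {A : Finset α} {X : Set (Fin n → α)}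
    (h : ∀ x ∈ X, ∀ i, x i ∈ A) : X.ncard ≤ A.card ^ n := by
  rw [← Fintype.card_piFinset_const, ← Set.ncard_coe_finset]
  exact Set.ncard_le_ncard fun x hx => Finset.mem_coe.2 (Fintype.mem_piFinset.2 (h x hx))

instance : Finite (subsetVectors n) :=
  ((Set.Finite.pi' fun _ : Fin n => ({0, 1} : Set ℝ).toFinite).subset fun _ hh => hh.1).to_subtype

lemma ncard_subsetVectors_le : (subsetVectors n).ncard ≤ 2 ^ n :=
  (ncard_le_card_pow (A := {0, 1}) fun h hh i => by simpa using hh.1 i).trans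
    (Nat.pow_le_pow_left Finset.card_le_two n)

lemma eq_neg_one_or_zero_or_one_of_mem_comparisonQueries {q : Fin n → ℝ}
    (hq : q ∈ comparisonQueries (subsetVectors n)) (i : Fin n) : q i = -1 ∨ q i = 0 ∨ q i = 1 := by
  rcases hq with hq | ⟨a, ha, b, hb, rfl⟩
  · exact .inr (hq.1 i)
  · rcases ha.1 i with h | h <;> rcases hb.1 i with h' | h' <;> simp [h, h']

lemma ncard_comparisonQueries_subsetVectors_le :
    (comparisonQueries (subsetVectors n)).ncard ≤ 3 ^ n :=
  (ncard_le_card_pow (A := {-1, 0, 1}) fun q hq i => by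
    simpa using eq_neg_one_or_zero_or_one_of_mem_comparisonQueries hq i).trans
    (Nat.pow_le_pow_left Finset.card_le_three n)

lemma cellBits_subsetVectors_le (hn : n ≠ 0) (X : Set (Fin n → ℝ)) :
    cellBits (comparisonQueries (subsetVectors n)) X ≤ (2 * n + 1) * n := by
  rw [cellBits, Nat.size_le, pow_mul]
  refine (cellCount_le _ X).trans_lt (Nat.pow_lt_pow_left ?_ hn)
  have hQ := ncard_comparisonQueries_subsetVectors_le (n := n)
  have hlt : 3 ^ n < 4 ^ n := Nat.pow_lt_pow_left (by norm_num) hn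
  rw [pow_succ, pow_mul, show 2 ^ 2 = 4 by rfl]
  omega

lemma two_le_size (hn : 2 ≤ n) : 2 ≤ n.size :=
  Nat.lt_size.2 hn

/-- Siegel's lemma applies to more than `4 n log n` vectors in `{0, 1}ⁿ`. -/
lemma four_mul_size_pow_lt (hn : 2 ≤ n) :
    (4 * (n * n.size)) ^ n < 2 ^ (4 * (n * n.size) - n) := by
  have hs := two_le_size hn
  have hlt : n * n.size < 2 ^ n.size * 2 ^ n.size :=
    Nat.mul_lt_mul'' n.lt_size_self Nat.lt_two_pow_self
  calc (4 * (n * n.size)) ^ n < (2 ^ (2 * n.size + 2)) ^ n := by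
        refine Nat.pow_lt_pow_left ?_ (by omega)
        rw [pow_add, two_mul, pow_add]
        omega
    _ = 2 ^ ((2 * n.size + 2) * n) := (pow_mul _ _ _).symm
    _ ≤ 2 ^ (4 * (n * n.size) - n) := by
        refine Nat.pow_le_pow_right two_pos (Nat.le_sub_of_add_le ?_)
        nlinarith

lemma inferenceDimLE_subsetVectors (hn : 2 ≤ n) :
    InferenceDimLE (subsetVectors n) (3 * (4 * (n * n.size) + 1)) :=
  inferenceDimLE_of_zero_one (by omega) (by nlinarith [two_le_size hn]) (four_mul_size_pow_lt hn)
    fun _ hh => hh.1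

lemma computableWithin_pointLocation_subsetVectors (hn : 2 ≤ n) :
    ComputableWithin (subsetVectors n) (pointLocation (subsetVectors n)) Set.univ
      (840 * (n ^ 2 * n.size)) := by
  refine (inferenceDimLE_subsetVectors hn).computableWithin_pointLocation.mono subset_rfl ?_
  have hs := two_le_size hn
  have hsize : (subsetVectors n).ncard.size ≤ n + 1 := Nat.size_le.2 <|
    ncard_subsetVectors_le.trans_lt (Nat.pow_lt_pow_right one_lt_two n.lt_succ_self)
  have hbits := cellBits_subsetVectors_le (by omega : n ≠ 0) Set.univ
  have hdim : 3 * (4 * (n * n.size) + 1) ≤ 13 * (n * n.size) := by nlinarith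
  have hn_sq : 2 * n ≤ n ^ 2 := by nlinarith
  calc _ ≤ 40 * (13 * (n * n.size) * (n + 1) + (2 * n + 1) * n) + 2 * ((2 * n + 1) * n) := by gcongr
    _ = 520 * (n ^ 2 * n.size) + 520 * (n * n.size) + 84 * n ^ 2 + 42 * n := by ring
    _ ≤ 840 * (n ^ 2 * n.size) := by nlinarith

lemma size_le_three_mul_log (hn : 2 ≤ n) : (n.size : ℝ) ≤ 3 * Real.log n := by
  obtain ⟨l, hl⟩ : ∃ l, n.size = l + 2 := Nat.exists_eq_add_of_le' (two_le_size hn)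
  have hpow : (2 : ℝ) ^ (l + 1) ≤ n := mod_cast Nat.lt_size.1 (by omega : l + 1 < n.size)
  have hlog : (l + 1) * Real.log 2 ≤ Real.log n := by
    simpa using Real.log_le_log (by positivity) hpow
  have htwo : (2 / 3 : ℝ) ≤ Real.log 2 := by linarith [Real.log_two_gt_d9]
  rw [hl]
  push_cast
  nlinarith

lemma subsetSum_iff {x : Fin n → ℝ} :
    SubsetSum x ↔ ∃ h, pointLocation (subsetVectors n) x h = 0 := by
  classical
  constructor
  · rintro ⟨I, ⟨i, hi⟩, hsum⟩
    refine ⟨⟨fun j => if j ∈ I then 1 else 0, fun j => ?_, fun h => ?_⟩, ?_⟩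
    · by_cases hj : j ∈ I <;> simp [hj]
    · simpa [hi] using congrFun h i
    · simp [pointLocation, dotProduct, hsum]
  · rintro ⟨⟨h, h01, hne⟩, hsum⟩
    obtain ⟨i, hi⟩ := Function.ne_iff.1 hne
    refine ⟨Finset.univ.filter fun j => h j = 1, ⟨i, by simpa using (h01 i).resolve_left hi⟩, ?_⟩
    rw [← sign_eq_zero_iff.1 hsum, Finset.sum_filter]
    refine Finset.sum_congr rfl fun j _ => ?_
    rcases h01 j with hj | hj <;> simp [hj]

lemma ComputableWithin.exists_ternary_tree {β : Type} {f : (Fin n → ℝ) → β} {k : ℕ}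
    (h : ComputableWithin (subsetVectors n) f Set.univ k) :
    ∃ T : LinearDecisionTree n β, (∀ x, T.eval x = f x) ∧ T.IsComparison (subsetVectors n) ∧
      (∀ q ∈ T.queries, ∀ i, q i = -1 ∨ q i = 0 ∨ q i = 1) ∧ T.depth ≤ k :=
  let ⟨T, hT, hTH, hTk⟩ := h
  ⟨T, fun x => hT x trivial, hTH,
    fun _ hq => eq_neg_one_or_zero_or_one_of_mem_comparisonQueries (hTH hq), hTk⟩

end SubsetSum

theorem mainTheorem7 :
    ∃ C : ℝ, 0 < C ∧ ∀ n : ℕ, 2 ≤ n →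
      (∃ T : LinearDecisionTree n Bool,
        (∀ x : Fin n → ℝ, T.eval x = true ↔ SubsetSum x) ∧
        T.IsComparison (subsetVectors n) ∧
        (∀ q ∈ T.queries, ∀ i, q i = -1 ∨ q i = 0 ∨ q i = 1) ∧
        (T.depth : ℝ) ≤ C * (n : ℝ) ^ 2 * Real.log n) ∧
      (∃ T : LinearDecisionTree n (subsetVectors n → SignType),
        (∀ x : Fin n → ℝ, T.eval x = pointLocation (subsetVectors n) x) ∧
        T.IsComparison (subsetVectors n) ∧
        (∀ q ∈ T.queries, ∀ i, q i = -1 ∨ q i = 0 ∨ q i = 1) ∧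
        (T.depth : ℝ) ≤ C * (n : ℝ) ^ 2 * Real.log n) := by
  classical
  refine ⟨2520, by norm_num, fun n hn => ?_⟩
  have depth_le : ∀ {k : ℕ}, k ≤ 840 * (n ^ 2 * n.size) →
      (k : ℝ) ≤ 2520 * (n : ℝ) ^ 2 * Real.log n := fun {k} hk =>
    calc (k : ℝ) ≤ 840 * ((n : ℝ) ^ 2 * n.size) := mod_cast hk
      _ ≤ 840 * ((n : ℝ) ^ 2 * (3 * Real.log n)) := by gcongr; exact size_le_three_mul_log hn
      _ = 2520 * (n : ℝ) ^ 2 * Real.log n := by ring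
  have hloc := computableWithin_pointLocation_subsetVectors hn
  obtain ⟨T, hT, hTH, hTq, hTk⟩ := (hloc.comp fun v => decide (∃ h, v h = 0)).exists_ternary_tree
  obtain ⟨T', hT', hTH', hTq', hTk'⟩ := hloc.exists_ternary_tree
  refine ⟨⟨T, fun x => ?_, hTH, hTq, depth_le hTk⟩, T', hT', hTH', hTq', depth_le hTk'⟩
  rw [hT, Function.comp_apply, decide_eq_true_iff, subsetSum_iff]
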